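/- Fix real numbers $1<q<p$. Let $H_q(z)=qz^{q-1}-(q-1)z^q$, and let $\omega_q:[0,1]\to[1,\frac{q}{q-1}]$ be the inverse of the strictly decreasing bijection $H_q:[1,\frac q{q-1}]\to[0,1]$. For $0<s_1^{\frac{q-1}{p-1}}\le s_2<1$ put $$\alpha(s_2)=\frac{\omega_q(s_2)^q}{s_2}-1,\qquad \tau(t)=\frac{p-q}{p}\cdot\frac{t^p-s_1}{t^{p-q}-\frac{s_1}{s_2}},$$ $$F_{s_1,s_2}(t)=q\Big(p\,\omega_q(\tau(t))^{q-1}-(p-1)\,\omega_q(\tau(t))^{q}\Big)\Big(t^{p-q}-\frac{s_1}{s_2}\Big)-(p-q)\,s_1\,\alpha(s_2),$$ and, for $\beta\in[0,\frac1{p-1}]$, let $t(\beta)=t(\beta,s_1,s_2)$ be the solution $t\ge 1$ of $$\frac{p-q}{p}\cdot\frac{t^p-s_1}{(\beta+1)^{q-1}}+\frac{(q-1)\beta}{(\beta+1)^q}\Big(t^p-s_1\frac{\omega_q(s_2)^q}{s_2}\Big)=t^{p-q}-\frac{s_1}{s_2}.$$ Let $t(s_1,s_2)$ be the greatest $t\in[1,t(0)]$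 with $F_{s_1,s_2}(t)\le 0$. Theorem. All these quantities are well defined on the domain $0<s_1^{\frac{q-1}{p-1}}\le s_2<1$: for each $\beta\in[0,\frac1{p-1}]$ the equation for $t(\beta)$ has exactly one solution $t\ge1$, the greatest $t\in[1,t(0)]$ with $F_{s_1,s_2}(t)\le0$ exists, and $$t(s_1,s_2)=\min\Big\{t(\beta,s_1,s_2):\beta\in\big[0,\tfrac1{p-1}\big]\Big\}.$$ Moreover, for each fixed $s_2\in(0,1)$ the function $s_1\mapsto t(s_1,s_2)$ is strictly decreasing on $\{s_1>0: s_1^{\frac{q-1}{p-1}}\le s_2\}$. -/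

import Mathlib

open Set

noncomputable section

namespace HardyConst

/-- The function `H_q(z) = q z^(q-1) - (q-1) z^q`, a strictly decreasing bijection of
`[1, q/(q-1)]` onto `[0, 1]` when `q > 1`. -/
def H (q z : ℝ) : ℝ := q * z ^ (q - 1) - (q - 1) * z ^ q

/-- `ω_q : [0, 1] → [1, q/(q-1)]`, the inverse function of `H_q` on `[1, q/(q-1)]`. -/
def omega (q : ℝ) : ℝ → ℝ := Function.invFunOn (H q) (Icc 1 (q / (q - 1)))

/-- `α(s₂) = ω_q(s₂)^q / s₂ - 1`. -/
def alpha (q s₂ : ℝ) : ℝ := omega q s₂ ^ q / s₂ - 1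

/-- `τ(s₁, s₂, t) = ((p - q)/p) (t^p - s₁) / (t^(p-q) - s₁/s₂)`. -/
def tau (p q s₁ s₂ t : ℝ) : ℝ :=
  (p - q) / p * ((t ^ p - s₁) / (t ^ (p - q) - s₁ / s₂))

/-- The function of `t` whose zeros `t ≥ 1` define `t(β) = t(β, s₁, s₂)`. The inequality
`G ≤ 0` is what the Hardy inequality with parameter `β` says about
`t ^ p = (∫ (Hardy mean of h)^p) / ∫ h^p`. -/
def G (p q s₁ s₂ β t : ℝ) : ℝ :=
  (p - q) / p * (t ^ p - s₁) / (β + 1) ^ (q - 1)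
    + (q - 1) * β / (β + 1) ^ q * (t ^ p - s₁ * (omega q s₂ ^ q / s₂))
    - (t ^ (p - q) - s₁ / s₂)

/-- `t(β) = t(β, s₁, s₂)`: the (unique) `t ≥ 1` with `G t = 0`. -/
def tBeta (p q s₁ s₂ β : ℝ) : ℝ := sSup {t : ℝ | 1 ≤ t ∧ G p q s₁ s₂ β t = 0}

/-- `F_{s₁,s₂}(t) = q (p ω_q(τ)^(q-1) - (p-1) ω_q(τ)^q) (t^(p-q) - s₁/s₂) - (p-q) s₁ α(s₂)`. -/
def F (p q s₁ s₂ t : ℝ) : ℝ :=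
  q * (p * omega q (tau p q s₁ s₂ t) ^ (q - 1) - (p - 1) * omega q (tau p q s₁ s₂ t) ^ q)
      * (t ^ (p - q) - s₁ / s₂)
    - (p - q) * s₁ * alpha q s₂

/-- The elements of `[1, t(0)]` at which `F_{s₁,s₂} ≤ 0`. -/
def admissible (p q s₁ s₂ : ℝ) : Set ℝ :=
  {t : ℝ | t ∈ Icc 1 (tBeta p q s₁ s₂ 0) ∧ F p q s₁ s₂ t ≤ 0}

/-- `t(s₁, s₂)`: the greatest element of `[1, t(0)]` at which `F_{s₁,s₂} ≤ 0`. -/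
def tConst (p q s₁ s₂ : ℝ) : ℝ := sSup (admissible p q s₁ s₂)

/-- The set of `s₁` with `0 < s₁^((q-1)/(p-1)) ≤ s₂`. -/
def dom (p q s₂ : ℝ) : Set ℝ := {s₁ : ℝ | 0 < s₁ ∧ s₁ ^ ((q - 1) / (p - 1)) ≤ s₂}

end HardyConst

end

/-!
Write `z = β + 1 ∈ [1, p/(p-1)]`, `D = t^(p-q) - s₁/s₂ > 0` and `E = t^p - s₁ ω_q(s₂)^q / s₂`.
Everything rests on the tangent-line inequality for `z ↦ z^q`, in the form
`H_q(w) z + (q-1) (z-1) w^q ≤ z^q` with equality at `z = w` (`H_mul_add_le_rpow`).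

* For each `β`, `G` is strictly increasing in `t ≥ 1` (`G_strictMonoOn`), negative at `t = 1`
  (`G_one_neg`) and tends to infinity, so `t(β)` exists, is unique, and `t ≤ t(β)` is equivalent to
  `G(t) ≤ 0` (`G_le_zero_iff`).
* On `[1, t(0)]` one has `τ ∈ (0, 1]`, and there `F ≤ 0` amounts to `E ≤ ω_q(τ)^q D`
  (`F_eq`). The tangent-line inequality with `w = ω_q(τ)` then gives `G ≤ 0` for every `β`, that is,
  `t ≤ t(β)` (`G_le_zero_of_F_le_zero`). So every admissible `t` is a lower bound for the `t(β)`.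
* The greatest admissible `t` is either `t(0)` or a zero of `F`; at a zero of `F` the choice
  `β = ω_q(τ) - 1` is the equality case and gives `G = 0` (`G_eq_zero_of_F_eq_zero`), so the lower
  bound is attained.
* For fixed `β` and `t`, `G` is affine in `s₁`, with a slope that is positive by the tangent-line
  inequality with `w = ω_q(s₂)` (`G_lt_G_of_lt`). Hence each `t(β)`, and so their minimum, is
  strictly decreasing in `s₁`.
-/

namespace HardyConst

variable {p q s₁ s₂ β t z w : ℝ}

/-! ### The tangent-line inequality -/

lemma rpow_eq_rpow_sub_one_mul (hz : 0 < z) (q : ℝ) : z ^ q = z ^ (q - 1) * z := by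
  rw [Real.rpow_sub_one hz.ne', div_mul_cancel₀ _ hz.ne']

/-- The graph of `z ↦ z^q` lies above its tangent line at `w`. -/
lemma tangent_le_rpow (hq : 1 < q) (hz : 0 < z) (hw : 0 < w) :
    q * w ^ (q - 1) * z - (q - 1) * w ^ q ≤ z ^ q := by
  have hb := one_add_mul_self_le_rpow_one_add (s := z / w - 1)
    (by linarith [div_pos hz hw]) hq.le
  rw [add_sub_cancel, Real.div_rpow hz.le hw.le, le_div_iff₀ (Real.rpow_pos_of_pos hw q)] at hb
  refine le_trans (le_of_eq ?_) hb
  rw [rpow_eq_rpow_sub_one_mul hw q]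
  field_simp
  ring

lemma tangent_lt_rpow (hq : 1 < q) (hz : 0 < z) (hw : 0 < w) (hzw : z ≠ w) :
    q * w ^ (q - 1) * z - (q - 1) * w ^ q < z ^ q := by
  have hb := one_add_mul_self_lt_rpow_one_add (s := z / w - 1)
    (by linarith [div_pos hz hw]) (sub_ne_zero.2 fun h => hzw ((div_eq_one_iff_eq hw.ne').1 h)) hq
  rw [add_sub_cancel, Real.div_rpow hz.le hw.le, lt_div_iff₀ (Real.rpow_pos_of_pos hw q)] at hb
  refine lt_of_eq_of_lt ?_ hb
  rw [rpow_eq_rpow_sub_one_mul hw q]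
  field_simp
  ring

/-- The tangent-line inequality for `z ↦ z^q` at `w`, rewritten in terms of `H_q(w)`. -/
lemma H_mul_add_le_rpow (hq : 1 < q) (hz : 0 < z) (hw : 0 < w) :
    H q w * z + (q - 1) * (z - 1) * w ^ q ≤ z ^ q := by
  have := tangent_le_rpow hq hz hw
  unfold H
  linarith

/-! ### The function `ω_q` -/

lemma H_lt_H (hq : 1 < q) {a b : ℝ} (ha : 1 ≤ a) (hab : a < b) : H q b < H q a := by
  have ha0 : 0 < a := by linarith
  have h1 := tangent_lt_rpow hq ha0 (ha0.trans hab) hab.ne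
  have h2 : a ^ (q - 1) ≤ b ^ (q - 1) := Real.rpow_le_rpow ha0.le hab.le (by linarith)
  have h3 := mul_le_mul_of_nonneg_right h2 (mul_nonneg (by linarith : 0 ≤ q) (sub_nonneg.2 ha))
  have h4 := rpow_eq_rpow_sub_one_mul ha0 q
  unfold H
  nlinarith

lemma H_one (q : ℝ) : H q 1 = 1 := by simp [H]

lemma H_conj (hq : 1 < q) : H q (q / (q - 1)) = 0 := by
  have h : 0 < q / (q - 1) := div_pos (by linarith) (by linarith)
  have h1 : q - 1 ≠ 0 := by linarith
  rw [H, rpow_eq_rpow_sub_one_mul h q]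
  field_simp
  ring

lemma one_le_conj (hq : 1 < q) : 1 ≤ q / (q - 1) := by
  rw [le_div_iff₀ (by linarith)]; linarith

lemma H_continuousOn (q : ℝ) : ContinuousOn (H q) (Icc 1 (q / (q - 1))) := by
  have h : ∀ r : ℝ, ContinuousOn (fun z : ℝ => z ^ r) (Icc 1 (q / (q - 1))) := fun r =>
    continuousOn_id.rpow_const fun x hx => Or.inl (by simp only [id]; linarith [hx.1])
  exact (continuousOn_const.mul (h _)).sub (continuousOn_const.mul (h _))

lemma H_surjOn (hq : 1 < q) : SurjOn (H q) (Icc 1 (q / (q - 1))) (Icc 0 1) := by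
  have := intermediate_value_Icc' (one_le_conj hq) (H_continuousOn q)
  rwa [H_conj hq, H_one] at this

lemma H_injOn (hq : 1 < q) : InjOn (H q) (Icc 1 (q / (q - 1))) :=
  StrictAntiOn.injOn fun _ ha _ _ hab => H_lt_H hq ha.1 hab

lemma omega_mem (hq : 1 < q) {y : ℝ} (hy : y ∈ Icc (0 : ℝ) 1) :
    omega q y ∈ Icc 1 (q / (q - 1)) := Function.invFunOn_mem (H_surjOn hq hy)

lemma H_omega (hq : 1 < q) {y : ℝ} (hy : y ∈ Icc (0 : ℝ) 1) : H q (omega q y) = y :=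
  Function.invFunOn_eq (H_surjOn hq hy)

lemma omega_H (hq : 1 < q) (hz : z ∈ Icc 1 (q / (q - 1))) : omega q (H q z) = z :=
  (H_injOn hq).leftInvOn_invFunOn hz

lemma omega_pos (hq : 1 < q) {y : ℝ} (hy : y ∈ Icc (0 : ℝ) 1) : 0 < omega q y :=
  one_pos.trans_le (omega_mem hq hy).1

lemma one_le_omega_rpow (hq : 1 < q) {y : ℝ} (hy : y ∈ Icc (0 : ℝ) 1) : 1 ≤ omega q y ^ q :=
  Real.one_le_rpow (omega_mem hq hy).1 (by linarith)

/-- The preimage of a closed set under `ω_q` is its image under `H_q`, hence compact. -/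
lemma omega_continuousOn (hq : 1 < q) : ContinuousOn (omega q) (Icc 0 1) := by
  rw [continuousOn_iff_isClosed]
  intro s hs
  have hc : IsCompact (Icc 1 (q / (q - 1)) ∩ s) := isCompact_Icc.inter_right hs
  refine ⟨H q '' (Icc 1 (q / (q - 1)) ∩ s),
    (hc.image_of_continuousOn ((H_continuousOn q).mono inter_subset_left)).isClosed, ?_⟩
  ext y
  constructor
  · rintro ⟨hys, hy⟩
    exact ⟨⟨omega q y, ⟨omega_mem hq hy, hys⟩, H_omega hq hy⟩, hy⟩
  · rintro ⟨⟨z, ⟨hz, hzs⟩, rfl⟩, hy⟩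
    exact ⟨by rwa [mem_preimage, omega_H hq hz], hy⟩

/-! ### Consequences of the domain condition -/

/-- On the domain, `s₁ ≤ s₂ v` with `v = s₁^((p-q)/(p-1))`, and `s₁ = v^((p-1)/(p-q))`; the last
bound is then Bernoulli's inequality. -/
lemma dom_bounds (hq : 1 < q) (hqp : q < p) (hs₂ : 0 < s₂) (hs₂' : s₂ < 1)
    (hs₁ : s₁ ∈ dom p q s₂) :
    s₁ < 1 ∧ s₁ / s₂ < 1 ∧ (p - q) / p * (1 - s₁) < 1 - s₁ / s₂ := by
  obtain ⟨h0, h1⟩ := hs₁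
  have hp1 : 0 < p - 1 := by linarith
  have hpq : 0 < p - q := by linarith
  have hs1 : s₁ < 1 := by
    by_contra! h
    linarith [Real.one_le_rpow h (div_nonneg (by linarith : 0 ≤ q - 1) hp1.le)]
  set v := s₁ ^ ((p - q) / (p - 1)) with hv
  have hv0 : 0 < v := Real.rpow_pos_of_pos h0 _
  have hv1 : v < 1 := Real.rpow_lt_one h0.le hs1 (by positivity)
  have hdiv : s₁ / s₂ ≤ v := by
    rw [div_le_iff₀ hs₂]
    calc s₁ = v * s₁ ^ ((q - 1) / (p - 1)) := by
          rw [hv, ← Real.rpow_add h0, ← add_div]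
          rw [show (p - q + (q - 1)) / (p - 1) = 1 by field_simp; ring, Real.rpow_one]
      _ ≤ v * s₂ := mul_le_mul_of_nonneg_left h1 hv0.le
  have hpow : v ^ ((p - 1) / (p - q)) = s₁ := by
    rw [hv, ← Real.rpow_mul h0.le,
      show (p - q) / (p - 1) * ((p - 1) / (p - q)) = 1 by field_simp, Real.rpow_one]
  have hb := one_add_mul_self_le_rpow_one_add (s := v - 1) (by linarith)
    (p := (p - 1) / (p - q)) (by rw [le_div_iff₀ hpq]; linarith)
  rw [add_sub_cancel, hpow] at hb
  refine ⟨hs1, hdiv.trans_lt hv1, ?_⟩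
  have hb' : (p - q) * (1 - s₁) ≤ (p - 1) * (1 - v) := by
    have := mul_le_mul_of_nonneg_left hb hpq.le
    field_simp at this
    linarith
  rw [div_mul_eq_mul_div, div_lt_iff₀ (by linarith)]
  nlinarith

lemma denom_pos (hqp : q < p) (hA : s₁ / s₂ < 1) (ht : 1 ≤ t) :
    0 < t ^ (p - q) - s₁ / s₂ := by
  linarith [Real.one_le_rpow ht (by linarith : 0 ≤ p - q)]

/-! ### The functions `t ↦ G(t)` and their zeros `t(β)` -/

lemma rpow_mul_G (hβ : 0 ≤ β) :
    (β + 1) ^ q * G p q s₁ s₂ β t = (β + 1) * ((p - q) / p * (t ^ p - s₁))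
      + (q - 1) * β * (t ^ p - s₁ * (omega q s₂ ^ q / s₂))
      - (β + 1) ^ q * (t ^ (p - q) - s₁ / s₂) := by
  have hz : 0 < β + 1 := by linarith
  have := (Real.rpow_pos_of_pos hz (q - 1)).ne'
  have := hz.ne'
  rw [G, rpow_eq_rpow_sub_one_mul hz q]
  field_simp

/-- The bound on `β` that makes `G` increasing in `t`: `p/(p-q)` times the coefficient of `t^p` in
`(β+1)^q G` dominates the coefficient of `-t^(p-q)`. Bernoulli's inequality at `1/(β+1)` bounds
`(β+1)^q` by `(β+1)/(q-(q-1)(β+1))`, which reduces this to a polynomial inequality. -/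
lemma rpow_le_coeff (hq : 1 < q) (hqp : q < p) (hβ : β ∈ Icc 0 (1 / (p - 1))) :
    (β + 1) ^ q ≤ p / (p - q) * ((β + 1) * ((p - q) / p) + (q - 1) * β) := by
  obtain ⟨hβ0, hβ1⟩ := hβ
  have hp0 : 0 < p := by linarith
  have hpq : 0 < p - q := by linarith
  have hz : 0 < β + 1 := by linarith
  rw [le_div_iff₀ (by linarith)] at hβ1
  have hb := one_add_mul_self_le_rpow_one_add (s := 1 / (β + 1) - 1)
    (by linarith [one_div_pos.2 hz]) hq.le
  rw [add_sub_cancel, Real.div_rpow zero_le_one hz.le, Real.one_rpow,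
    le_div_iff₀ (Real.rpow_pos_of_pos hz q)] at hb
  have hb' : (1 - (q - 1) * β) * (β + 1) ^ q ≤ β + 1 := by
    have := mul_le_mul_of_nonneg_right hb hz.le
    refine le_trans (le_of_eq ?_) (this.trans_eq (one_mul _))
    field_simp
    ring
  have hd : 0 < 1 - (q - 1) * β := by nlinarith
  refine le_of_mul_le_mul_left (hb'.trans ?_) hd
  have key : 0 ≤ (q - 1) * β * (q * (1 - β * (p - 1))) :=
    mul_nonneg (mul_nonneg (by linarith) hβ0) (mul_nonneg (by linarith) (by linarith))
  have : (1 - (q - 1) * β) * (p / (p - q) * ((β + 1) * ((p - q) / p) + (q - 1) * β)) - (β + 1)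
      = (q - 1) * β * (q * (1 - β * (p - 1))) / (p - q) := by
    field_simp
    ring
  linarith [div_nonneg key hpq.le]

/-- Convexity of `u ↦ u^(p/(p-q))` on `[1, ∞)`, read at `u = t^(p-q)`. -/
lemma rpow_sub_rpow_lt (hq : 0 < q) (hqp : q < p) {a b : ℝ} (ha : 1 ≤ a) (hab : a < b) :
    p / (p - q) * (b ^ (p - q) - a ^ (p - q)) < b ^ p - a ^ p := by
  have hpq : 0 < p - q := by linarith
  have ha0 : 0 < a := by linarith
  have hb0 : 0 < b := by linarith
  have hc : 1 < p / (p - q) := by rw [lt_div_iff₀ hpq]; linarith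
  have e : ∀ x : ℝ, 0 < x → (x ^ (p - q)) ^ (p / (p - q)) = x ^ p := fun x hx => by
    rw [← Real.rpow_mul hx.le, mul_div_cancel₀ _ hpq.ne']
  have hlt : a ^ (p - q) < b ^ (p - q) := Real.rpow_lt_rpow ha0.le hab hpq
  have ha' : 0 < a ^ (p - q) := Real.rpow_pos_of_pos ha0 _
  have h := tangent_lt_rpow hc (ha'.trans hlt) ha' hlt.ne'
  have h2 := rpow_eq_rpow_sub_one_mul ha' (p / (p - q))
  rw [e b hb0] at h
  rw [e a ha0] at h h2
  have h3 : 1 ≤ (a ^ (p - q)) ^ (p / (p - q) - 1) :=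
    Real.one_le_rpow (Real.one_le_rpow ha hpq.le) (by linarith)
  have h4 := mul_le_mul_of_nonneg_right h3
    (mul_nonneg (by linarith : 0 ≤ p / (p - q)) (sub_nonneg.2 hlt.le))
  rw [h2] at h ⊢
  linarith

lemma G_strictMonoOn (hq : 1 < q) (hqp : q < p) (hβ : β ∈ Icc 0 (1 / (p - 1))) :
    StrictMonoOn (G p q s₁ s₂ β) (Ici 1) := by
  intro a ha b hb hab
  have hz : 0 < β + 1 := by linarith [hβ.1]
  have hzq := Real.rpow_pos_of_pos hz q
  have hpq : 0 < p - q := by linarith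
  refine lt_of_mul_lt_mul_left ?_ hzq.le
  rw [rpow_mul_G hβ.1, rpow_mul_G hβ.1]
  have h1 := rpow_le_coeff hq hqp hβ
  have h2 := rpow_sub_rpow_lt (by linarith) hqp ha hab
  have h3 : 0 < b ^ (p - q) - a ^ (p - q) :=
    sub_pos.2 (Real.rpow_lt_rpow (by linarith [mem_Ici.1 ha]) hab hpq)
  have hc : 0 < (β + 1) * ((p - q) / p) + (q - 1) * β :=
    add_pos_of_pos_of_nonneg (mul_pos hz (div_pos hpq (by linarith)))
      (mul_nonneg (by linarith) hβ.1)
  have h4 := mul_le_mul_of_nonneg_right h1 h3.le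
  have h5 := mul_lt_mul_of_pos_left h2 hc
  linarith

/-- At `t = 1`, `(β+1)^(q-1) G` is largest for `β = 0`, where it is negative on the domain. -/
lemma G_one_neg (hq : 1 < q) (hqp : q < p) (hs₂ : 0 < s₂) (hs₂' : s₂ < 1)
    (hs₁ : s₁ ∈ dom p q s₂) (hβ : 0 ≤ β) : G p q s₁ s₂ β 1 < 0 := by
  obtain ⟨-, hA, hlt⟩ := dom_bounds hq hqp hs₂ hs₂' hs₁
  have hz : 0 < β + 1 := by linarith
  have hzq := Real.rpow_pos_of_pos hz q
  refine lt_of_mul_lt_mul_left ?_ hzq.le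
  rw [mul_zero, rpow_mul_G hβ]
  simp only [Real.one_rpow]
  have hbern := one_add_mul_self_le_rpow_one_add (s := β) (by linarith) hq.le
  rw [add_comm 1 β] at hbern
  have hw : s₁ / s₂ ≤ s₁ * (omega q s₂ ^ q / s₂) := by
    rw [← mul_div_assoc]
    gcongr
    exact le_mul_of_one_le_right hs₁.1.le (one_le_omega_rpow hq ⟨hs₂.le, hs₂'.le⟩)
  have h1 := mul_lt_mul_of_pos_left hlt hz
  have h2 := mul_le_mul_of_nonneg_left hw (mul_nonneg (by linarith : 0 ≤ q - 1) hβ)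
  have h3 := mul_le_mul_of_nonneg_right hbern (sub_nonneg.2 hA.le)
  linarith

lemma G_continuousOn : ContinuousOn (G p q s₁ s₂ β) (Ici 1) := by
  have h : ∀ r : ℝ, ContinuousOn (fun t : ℝ => t ^ r) (Ici 1) := fun r =>
    continuousOn_id.rpow_const fun x hx => Or.inl (by simp only [id]; linarith [mem_Ici.1 hx])
  unfold G
  exact (((continuousOn_const.mul ((h _).sub continuousOn_const)).div_const _).add
    (continuousOn_const.mul ((h _).sub continuousOn_const))).sub ((h _).sub continuousOn_const)

lemma exists_G_nonneg (hq : 1 < q) (hqp : q < p) (hβ : 0 ≤ β) :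
    ∃ t, 1 ≤ t ∧ 0 ≤ G p q s₁ s₂ β t := by
  have hz : 0 < β + 1 := by linarith
  have hzq := Real.rpow_pos_of_pos hz q
  have hpq : 0 < p - q := by linarith
  set c := (β + 1) * ((p - q) / p) + (q - 1) * β with hc
  have hc0 : 0 < c := add_pos_of_pos_of_nonneg (mul_pos hz (div_pos hpq (by linarith)))
      (mul_nonneg (by linarith) hβ)
  set d := - (β + 1) * ((p - q) / p) * s₁ - (q - 1) * β * (s₁ * (omega q s₂ ^ q / s₂))
    + (β + 1) ^ q * (s₁ / s₂) with hd
  have hlim : Filter.Tendsto (fun t : ℝ => t ^ (p - q) * (c * t ^ q + -(β + 1) ^ q) + d)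
      Filter.atTop Filter.atTop :=
    Filter.tendsto_atTop_add_const_right _ _ ((tendsto_rpow_atTop hpq).atTop_mul_atTop₀
      (Filter.tendsto_atTop_add_const_right _ _
        ((tendsto_rpow_atTop (by linarith)).const_mul_atTop hc0)))
  obtain ⟨t, ht0, ht1⟩ :=
    ((hlim.eventually_ge_atTop 0).and (Filter.eventually_ge_atTop (1 : ℝ))).exists
  refine ⟨t, ht1, nonneg_of_mul_nonneg_right ?_ hzq⟩
  rw [rpow_mul_G hβ]
  refine ht0.trans_eq ?_
  have : t ^ p = t ^ (p - q) * t ^ q := by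
    rw [← Real.rpow_add (by linarith), sub_add_cancel]
  rw [hd, hc, this]
  ring

lemma G_zeros_eq_singleton (hq : 1 < q) (hqp : q < p) (hs₂ : 0 < s₂) (hs₂' : s₂ < 1)
    (hs₁ : s₁ ∈ dom p q s₂) (hβ : β ∈ Icc 0 (1 / (p - 1))) :
    {t : ℝ | 1 ≤ t ∧ G p q s₁ s₂ β t = 0} = {tBeta p q s₁ s₂ β} := by
  obtain ⟨T, hT1, hT⟩ := exists_G_nonneg (s₁ := s₁) (s₂ := s₂) hq hqp hβ.1
  obtain ⟨t, ht, ht0⟩ := intermediate_value_Icc hT1 (G_continuousOn.mono Icc_subset_Ici_self)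
    ⟨(G_one_neg hq hqp hs₂ hs₂' hs₁ hβ.1).le, hT⟩
  have h : {t : ℝ | 1 ≤ t ∧ G p q s₁ s₂ β t = 0} = {t} := by
    ext x
    constructor
    · rintro ⟨hx1, hx⟩
      exact (G_strictMonoOn hq hqp hβ).injOn hx1 ht.1 (hx.trans ht0.symm)
    · rintro rfl
      exact ⟨ht.1, ht0⟩
  rw [tBeta, h, csSup_singleton]

lemma tBeta_spec (hq : 1 < q) (hqp : q < p) (hs₂ : 0 < s₂) (hs₂' : s₂ < 1)
    (hs₁ : s₁ ∈ dom p q s₂) (hβ : β ∈ Icc 0 (1 / (p - 1))) :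
    1 ≤ tBeta p q s₁ s₂ β ∧ G p q s₁ s₂ β (tBeta p q s₁ s₂ β) = 0 :=
  (G_zeros_eq_singleton hq hqp hs₂ hs₂' hs₁ hβ).symm.subset (mem_singleton _)

lemma G_le_zero_iff (hq : 1 < q) (hqp : q < p) (hs₂ : 0 < s₂) (hs₂' : s₂ < 1)
    (hs₁ : s₁ ∈ dom p q s₂) (hβ : β ∈ Icc 0 (1 / (p - 1))) (ht : 1 ≤ t) :
    G p q s₁ s₂ β t ≤ 0 ↔ t ≤ tBeta p q s₁ s₂ β := by
  obtain ⟨h1, h0⟩ := tBeta_spec hq hqp hs₂ hs₂' hs₁ hβ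
  rw [← h0]
  exact (G_strictMonoOn hq hqp hβ).le_iff_le ht h1

lemma zero_mem_Icc (hq : 1 < q) (hqp : q < p) : (0 : ℝ) ∈ Icc 0 (1 / (p - 1)) :=
  ⟨le_rfl, one_div_nonneg.2 (by linarith)⟩

/-! ### The function `F` and its relation to `G` -/

lemma denom_mul_tau (hqp : q < p) (hA : s₁ / s₂ < 1) (ht : 1 ≤ t) :
    (t ^ (p - q) - s₁ / s₂) * tau p q s₁ s₂ t = (p - q) / p * (t ^ p - s₁) := by
  have := (denom_pos hqp hA ht).ne'
  rw [tau, mul_left_comm, mul_div_cancel₀ _ this]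

/-- `τ ≤ 1` is the inequality `G ≤ 0` for `β = 0`. -/
lemma tau_mem_Icc (hq : 1 < q) (hqp : q < p) (hs₂ : 0 < s₂) (hs₂' : s₂ < 1)
    (hs₁ : s₁ ∈ dom p q s₂) (ht : t ∈ Icc 1 (tBeta p q s₁ s₂ 0)) :
    tau p q s₁ s₂ t ∈ Icc (0 : ℝ) 1 := by
  obtain ⟨hs1, hA, -⟩ := dom_bounds hq hqp hs₂ hs₂' hs₁
  have hD := denom_pos hqp hA ht.1
  have hm := denom_mul_tau hqp hA ht.1
  have htp : 1 ≤ t ^ p := Real.one_le_rpow ht.1 (by linarith)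
  have hG := (G_le_zero_iff hq hqp hs₂ hs₂' hs₁ (zero_mem_Icc hq hqp) ht.1).2 ht.2
  constructor
  · refine nonneg_of_mul_nonneg_right ?_ hD
    rw [hm]
    exact mul_nonneg (div_nonneg (by linarith) (by linarith)) (by linarith)
  · refine le_of_mul_le_mul_left ?_ hD
    rw [hm]
    simp only [G, zero_add, Real.one_rpow, div_one, mul_zero, zero_mul, add_zero] at hG
    linarith

/-- Substituting `τ = q ω_q(τ)^(q-1) - (q-1) ω_q(τ)^q` eliminates the power `q - 1` from `F`. -/
lemma F_eq (hq : 1 < q) (hqp : q < p) (hA : s₁ / s₂ < 1) (ht : 1 ≤ t)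
    (hτ : tau p q s₁ s₂ t ∈ Icc (0 : ℝ) 1) :
    F p q s₁ s₂ t = (p - q) * (t ^ p - s₁ * (omega q s₂ ^ q / s₂)
      - omega q (tau p q s₁ s₂ t) ^ q * (t ^ (p - q) - s₁ / s₂)) := by
  have hm := denom_mul_tau hqp hA ht
  have hp : p ≠ 0 := by linarith
  have hH := H_omega hq hτ
  rw [H] at hH
  have hm' : p * ((t ^ (p - q) - s₁ / s₂) * tau p q s₁ s₂ t) = (p - q) * (t ^ p - s₁) := by
    rw [hm]; field_simp
  rw [F, alpha]
  linear_combination hm' + p * (t ^ (p - q) - s₁ / s₂) * hH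

lemma F_continuousOn (hq : 1 < q) (hqp : q < p) (hs₂ : 0 < s₂) (hs₂' : s₂ < 1)
    (hs₁ : s₁ ∈ dom p q s₂) : ContinuousOn (F p q s₁ s₂) (Icc 1 (tBeta p q s₁ s₂ 0)) := by
  obtain ⟨-, hA, -⟩ := dom_bounds hq hqp hs₂ hs₂' hs₁
  have h : ∀ r : ℝ, ContinuousOn (fun t : ℝ => t ^ r) (Icc 1 (tBeta p q s₁ s₂ 0)) := fun r =>
    continuousOn_id.rpow_const fun x hx => Or.inl (by simp only [id]; linarith [hx.1])
  have hτ : ContinuousOn (tau p q s₁ s₂) (Icc 1 (tBeta p q s₁ s₂ 0)) :=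
    continuousOn_const.mul (((h _).sub continuousOn_const).div ((h _).sub continuousOn_const)
      fun x hx => (denom_pos hqp hA hx.1).ne')
  have hmaps : MapsTo (tau p q s₁ s₂) (Icc 1 (tBeta p q s₁ s₂ 0)) (Icc 0 1) :=
    fun x hx => tau_mem_Icc hq hqp hs₂ hs₂' hs₁ hx
  have hω := (omega_continuousOn hq).comp hτ hmaps
  have hω' : ∀ r : ℝ, ContinuousOn (fun t : ℝ => omega q (tau p q s₁ s₂ t) ^ r)
      (Icc 1 (tBeta p q s₁ s₂ 0)) := fun r =>
    hω.rpow_const fun x hx => Or.inl (omega_pos hq (hmaps hx)).ne'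
  exact ((continuousOn_const.mul ((continuousOn_const.mul (hω' _)).sub
    (continuousOn_const.mul (hω' _)))).mul ((h _).sub continuousOn_const)).sub continuousOn_const

lemma G_le_zero_of_F_le_zero (hq : 1 < q) (hqp : q < p) (hA : s₁ / s₂ < 1) (ht : 1 ≤ t)
    (hτ : tau p q s₁ s₂ t ∈ Icc (0 : ℝ) 1) (hF : F p q s₁ s₂ t ≤ 0) (hβ : 0 ≤ β) :
    G p q s₁ s₂ β t ≤ 0 := by
  have hz : 0 < β + 1 := by linarith
  have hD := denom_pos hqp hA ht
  rw [F_eq hq hqp hA ht hτ] at hF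
  have hE := nonpos_of_mul_nonpos_right hF (by linarith : 0 < p - q)
  have hk := mul_le_mul_of_nonneg_right (H_mul_add_le_rpow hq hz (omega_pos hq hτ)) hD.le
  rw [H_omega hq hτ, add_sub_cancel_right] at hk
  have hE' := mul_le_mul_of_nonneg_left hE (mul_nonneg (by linarith : 0 ≤ q - 1) hβ)
  refine nonpos_of_mul_nonpos_right ?_ (Real.rpow_pos_of_pos hz q)
  rw [rpow_mul_G hβ, ← denom_mul_tau hqp hA ht]
  linarith

lemma G_eq_zero_of_F_eq_zero (hq : 1 < q) (hqp : q < p) (hA : s₁ / s₂ < 1) (ht : 1 ≤ t)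
    (hτ : tau p q s₁ s₂ t ∈ Icc (0 : ℝ) 1) (hF : F p q s₁ s₂ t = 0) :
    G p q s₁ s₂ (omega q (tau p q s₁ s₂ t) - 1) t = 0 := by
  have hω := omega_pos hq hτ
  have h1 := (omega_mem hq hτ).1
  have hH := H_omega hq hτ
  rw [H] at hH
  rw [F_eq hq hqp hA ht hτ] at hF
  have hE := (mul_eq_zero.1 hF).resolve_left (by linarith)
  have hpow := rpow_eq_rpow_sub_one_mul hω q
  have h0 := rpow_mul_G (p := p) (q := q) (s₁ := s₁) (s₂ := s₂) (t := t)
    (sub_nonneg.2 h1)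
  rw [sub_add_cancel] at h0
  refine (mul_eq_zero.1 (h0.trans ?_)).resolve_left (Real.rpow_pos_of_pos hω q).ne'
  rw [← denom_mul_tau hqp hA ht]
  linear_combination (q - 1) * (omega q (tau p q s₁ s₂ t) - 1) * hE
    - omega q (tau p q s₁ s₂ t) * (t ^ (p - q) - s₁ / s₂) * hH
    - q * (t ^ (p - q) - s₁ / s₂) * hpow

/-- At a zero of `F` the first factor of its leading term is nonnegative, as `α(s₂) ≥ 0`; this is
the upper bound `ω_q(τ) ≤ p/(p-1)`. -/
lemma omega_tau_sub_one_mem (hq : 1 < q) (hqp : q < p) (hs₂ : 0 < s₂) (hs₂' : s₂ < 1)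
    (h0 : 0 < s₁) (hA : s₁ / s₂ < 1) (ht : 1 ≤ t)
    (hτ : tau p q s₁ s₂ t ∈ Icc (0 : ℝ) 1) (hF : F p q s₁ s₂ t = 0) :
    omega q (tau p q s₁ s₂ t) - 1 ∈ Icc 0 (1 / (p - 1)) := by
  have hω := omega_pos hq hτ
  refine ⟨sub_nonneg.2 (omega_mem hq hτ).1, ?_⟩
  have hα : 0 ≤ alpha q s₂ := by
    have := one_le_omega_rpow hq (⟨hs₂.le, hs₂'.le⟩ : s₂ ∈ Icc (0 : ℝ) 1)
    rw [alpha, sub_nonneg, le_div_iff₀ hs₂]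
    linarith
  rw [F, sub_eq_zero] at hF
  have hnn : 0 ≤ (p - q) * s₁ * alpha q s₂ :=
    mul_nonneg (mul_nonneg (by linarith) h0.le) hα
  rw [← hF] at hnn
  have h1 := nonneg_of_mul_nonneg_right
    (nonneg_of_mul_nonneg_left hnn (denom_pos hqp hA ht)) (by linarith : 0 < q)
  rw [rpow_eq_rpow_sub_one_mul hω q] at h1
  have h2 : 0 ≤ omega q (tau p q s₁ s₂ t) ^ (q - 1)
      * (p - (p - 1) * omega q (tau p q s₁ s₂ t)) := by linarith
  have h3 := nonneg_of_mul_nonneg_right h2 (Real.rpow_pos_of_pos hω _)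
  rw [le_div_iff₀ (by linarith)]
  linarith

/-! ### The greatest admissible element -/

lemma one_mem_admissible (hq : 1 < q) (hqp : q < p) (hs₂ : 0 < s₂) (hs₂' : s₂ < 1)
    (hs₁ : s₁ ∈ dom p q s₂) : 1 ∈ admissible p q s₁ s₂ := by
  obtain ⟨-, hA, -⟩ := dom_bounds hq hqp hs₂ hs₂' hs₁
  have h1 : (1 : ℝ) ∈ Icc 1 (tBeta p q s₁ s₂ 0) :=
    ⟨le_rfl, (tBeta_spec hq hqp hs₂ hs₂' hs₁ (zero_mem_Icc hq hqp)).1⟩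
  have hτ := tau_mem_Icc hq hqp hs₂ hs₂' hs₁ h1
  refine ⟨h1, ?_⟩
  rw [F_eq hq hqp hA le_rfl hτ]
  refine mul_nonpos_of_nonneg_of_nonpos (by linarith) ?_
  simp only [Real.one_rpow]
  have hw : s₁ / s₂ ≤ s₁ * (omega q s₂ ^ q / s₂) := by
    rw [← mul_div_assoc]
    gcongr
    exact le_mul_of_one_le_right hs₁.1.le (one_le_omega_rpow hq ⟨hs₂.le, hs₂'.le⟩)
  have := mul_le_mul_of_nonneg_right (one_le_omega_rpow hq hτ) (sub_nonneg.2 hA.le)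
  linarith

lemma isGreatest_tConst (hq : 1 < q) (hqp : q < p) (hs₂ : 0 < s₂) (hs₂' : s₂ < 1)
    (hs₁ : s₁ ∈ dom p q s₂) : IsGreatest (admissible p q s₁ s₂) (tConst p q s₁ s₂) := by
  have hcl : IsClosed (admissible p q s₁ s₂) :=
    (F_continuousOn hq hqp hs₂ hs₂' hs₁).preimage_isClosed_of_isClosed isClosed_Icc isClosed_Iic
  have hco : IsCompact (admissible p q s₁ s₂) :=
    isCompact_Icc.of_isClosed_subset hcl fun _ h => h.1
  exact hco.isGreatest_sSup ⟨1, one_mem_admissible hq hqp hs₂ hs₂' hs₁⟩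

lemma isLeast_tConst (hq : 1 < q) (hqp : q < p) (hs₂ : 0 < s₂) (hs₂' : s₂ < 1)
    (hs₁ : s₁ ∈ dom p q s₂) :
    IsLeast (tBeta p q s₁ s₂ '' Icc (0 : ℝ) (1 / (p - 1))) (tConst p q s₁ s₂) := by
  obtain ⟨-, hA, -⟩ := dom_bounds hq hqp hs₂ hs₂' hs₁
  obtain ⟨⟨hT, hFT⟩, hmax⟩ := isGreatest_tConst hq hqp hs₂ hs₂' hs₁
  have hτ := tau_mem_Icc hq hqp hs₂ hs₂' hs₁ hT
  constructor
  · rcases hT.2.eq_or_lt with h | h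
    · exact ⟨0, zero_mem_Icc hq hqp, h.symm⟩
    -- If `F` were negative at the greatest admissible point, it would be so slightly to the right.
    have hF0 : F p q s₁ s₂ (tConst p q s₁ s₂) = 0 := by
      by_contra hne
      have hev := (F_continuousOn hq hqp hs₂ hs₂' hs₁ _ hT).eventually_lt_const
        (lt_of_le_of_ne hFT hne)
      have hev' := hev.filter_mono (nhdsWithin_mono _ (t := Icc 1 (tBeta p q s₁ s₂ 0))
        (s := Ioo (tConst p q s₁ s₂) (tBeta p q s₁ s₂ 0))
        fun x hx => ⟨hT.1.trans hx.1.le, hx.2.le⟩)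
      have := left_nhdsWithin_Ioo_neBot h
      obtain ⟨x, hx, hxI⟩ := (hev'.and self_mem_nhdsWithin).exists
      exact (hmax ⟨⟨hT.1.trans hxI.1.le, hxI.2.le⟩, hx.le⟩).not_gt hxI.1
    have hmem := omega_tau_sub_one_mem hq hqp hs₂ hs₂' hs₁.1 hA hT.1 hτ hF0
    refine ⟨_, hmem, ?_⟩
    exact ((G_zeros_eq_singleton hq hqp hs₂ hs₂' hs₁ hmem).subset
      ⟨hT.1, G_eq_zero_of_F_eq_zero hq hqp hA hT.1 hτ hF0⟩).symm
  · rintro _ ⟨β, hβ, rfl⟩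
    exact (G_le_zero_iff hq hqp hs₂ hs₂' hs₁ hβ hT.1).1
      (G_le_zero_of_F_le_zero hq hqp hA hT.1 hτ hFT hβ.1)

/-! ### Monotonicity in `s₁` -/

lemma G_lt_G_of_lt (hq : 1 < q) (hqp : q < p) (hs₂ : 0 < s₂) (hs₂' : s₂ < 1) (hβ : 0 ≤ β)
    {a b : ℝ} (hab : a < b) : G p q a s₂ β t < G p q b s₂ β t := by
  have hz : 0 < β + 1 := by linarith
  have hy : s₂ ∈ Icc (0 : ℝ) 1 := ⟨hs₂.le, hs₂'.le⟩
  have hk := H_mul_add_le_rpow hq hz (omega_pos hq hy)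
  rw [H_omega hq hy, add_sub_cancel_right] at hk
  refine lt_of_mul_lt_mul_left ?_ (Real.rpow_pos_of_pos hz q).le
  rw [rpow_mul_G hβ, rpow_mul_G hβ]
  -- The slope of `(β+1)^q G` in `s₁` is at least `(β+1) q / p`.
  have hslope : (β + 1) ≤ (β + 1) ^ q / s₂ - (q - 1) * β * (omega q s₂ ^ q / s₂) := by
    rw [← mul_div_assoc, ← sub_div, le_div_iff₀ hs₂]
    linarith
  have hlt : (β + 1) * ((p - q) / p) < β + 1 := by
    refine mul_lt_of_lt_one_right hz ?_
    rw [div_lt_one (by linarith)]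
    linarith
  have h := mul_pos (sub_pos.2 hab) (sub_pos.2 (hlt.trans_le hslope))
  have e : (b - a) * ((β + 1) ^ q / s₂ - (q - 1) * β * (omega q s₂ ^ q / s₂)
      - (β + 1) * ((p - q) / p)) = ((β + 1) * ((p - q) / p * (t ^ p - b))
      + (q - 1) * β * (t ^ p - b * (omega q s₂ ^ q / s₂))
      - (β + 1) ^ q * (t ^ (p - q) - b / s₂)) - ((β + 1) * ((p - q) / p * (t ^ p - a))
      + (q - 1) * β * (t ^ p - a * (omega q s₂ ^ q / s₂))
      - (β + 1) ^ q * (t ^ (p - q) - a / s₂)) := by ring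
  linarith

lemma tBeta_strictAntiOn (hq : 1 < q) (hqp : q < p) (hs₂ : 0 < s₂) (hs₂' : s₂ < 1)
    (hβ : β ∈ Icc 0 (1 / (p - 1))) :
    StrictAntiOn (fun s₁ => tBeta p q s₁ s₂ β) (dom p q s₂) := by
  intro a ha b hb hab
  obtain ⟨h1, h0⟩ := tBeta_spec hq hqp hs₂ hs₂' ha hβ
  have hlt := G_lt_G_of_lt (t := tBeta p q a s₂ β) hq hqp hs₂ hs₂' hβ.1 hab
  rw [h0] at hlt
  by_contra! hle
  exact hlt.not_ge ((G_le_zero_iff hq hqp hs₂ hs₂' hb hβ h1).2 hle)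

end HardyConst

open HardyConst in
theorem mainTheorem1 (p q : ℝ) (hq : 1 < q) (hqp : q < p) (s₂ : ℝ) (hs₂ : 0 < s₂) (hs₂' : s₂ < 1) :
    (∀ s₁ ∈ HardyConst.dom p q s₂,
      (∀ β ∈ Set.Icc (0 : ℝ) (1 / (p - 1)),
        {t : ℝ | 1 ≤ t ∧ HardyConst.G p q s₁ s₂ β t = 0} = {HardyConst.tBeta p q s₁ s₂ β}) ∧
      IsGreatest (HardyConst.admissible p q s₁ s₂) (HardyConst.tConst p q s₁ s₂) ∧
      IsLeast (HardyConst.tBeta p q s₁ s₂ '' Set.Icc (0 : ℝ) (1 / (p - 1)))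
        (HardyConst.tConst p q s₁ s₂)) ∧
    StrictAntiOn (fun s₁ => HardyConst.tConst p q s₁ s₂) (HardyConst.dom p q s₂) := by
  refine ⟨fun s₁ hs₁ => ⟨fun β hβ => G_zeros_eq_singleton hq hqp hs₂ hs₂' hs₁ hβ,
    isGreatest_tConst hq hqp hs₂ hs₂' hs₁, isLeast_tConst hq hqp hs₂ hs₂' hs₁⟩, ?_⟩
  intro a ha b hb hab
  -- A minimizer `β` for the smaller `s₁` bounds the minimum for the larger one.
  obtain ⟨β, hβ, hβa⟩ := (isLeast_tConst hq hqp hs₂ hs₂' ha).1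
  calc tConst p q b s₂ ≤ tBeta p q b s₂ β :=
        (isLeast_tConst hq hqp hs₂ hs₂' hb).2 ⟨β, hβ, rfl⟩
    _ < tBeta p q a s₂ β := tBeta_strictAntiOn hq hqp hs₂ hs₂' hβ ha hb hab
    _ = tConst p q a s₂ := hβa
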